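/- Let $d\ge 2$ be an integer, let $(G_n)_{n\ge 1}$ be groups, let $\rho_n\colon G_n\to S_n$ be homomorphisms and let $\kappa_k^n\colon G_n\to G_{n+d-1}$ ($1\le k\le n$) be injective functions, written to the right of their argument. For $\sigma\in S_n$ and $1\le k\le n$ let $(\sigma)\varsigma_k^n\in S_{n+d-1}$ be the permutation obtained from $\sigma$ by replacing the point $k$ of the domain by the block $k,\dots,k+d-1$ and the point $\sigma(k)$ of the codomain by the block $\sigma(k),\dots,\sigma(k)+d-1$ (shifting all points to the right of these by $d-1$), mapping the first block onto the second in an order-preserving way and all other points as $\sigma$ does. Suppose that these data form a $d$-ary cloning system, i.e. for all $g,h\in G_n$: - (C1) $(gh)\kappa_k^n=(g)\kappa_{\rho_n(h)(k)}^n\,(h)\kappa_k^n$ for $1\le k\le n$; - (C2) $((g)\kappa_\ell^n)\kappa_k^{n+d-1}=((g)\kappa_k^n)\kappa_{\ell+d-1}^{n+d-1}$ for $1\le k<\ell\le n$; - (C3) $\rho_{n+d-1}((g)\kappa_k^n)(i)=\big((\rho_n(g))\varsigma_k^n\big)(i)$ for $1\le k\le n$ and all $i\in\{1,\dots,n+d-1\}\setminus\{k,\dots,k+d-1\}$;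 and that it is fully compatible, i.e. the equation in (C3) holds for all $1\le i\le n+d-1$. A $d$-ary tree is a finite rooted tree in which every non-leaf vertex has $d$ ordered children. Let $\mathscr{T}_d(G_*)$ be the set of triples $(T_-,g,T_+)$, where $T_\pm$ are $d$-ary trees with the same number $n$ of leaves and $g\in G_n$, modulo the equivalence relation generated by expansions $(T_-,g,T_+)\sim(T_-',(g)\kappa_k^n,T_+')$, where $T_+'$ is $T_+$ with a $d$-caret added to its $k$-th leaf and $T_-'$ is $T_-$ with a $d$-caret added to its $\rho_n(g)(k)$-th leaf. It is a group under the well-defined product determined by $[T_-,g,U][U,h,U_+]=[T_-,gh,U_+]$. A group is ICC if the conjugacy class of every non-trivial element is infinite. Theorem. If $G_n$ is ICC for every $n\ge 1$, then $\mathscr{T}_d(G_*)$ is ICC. -/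

import Mathlib

/-- A group is ICC if the conjugacy class of every non-trivial element is infinite. -/
def IsICC (Γ : Type*) [Group Γ] : Prop :=
  ∀ g : Γ, g ≠ 1 → (conjugatesOf g).Infinite

/-! ### `d`-ary trees -/

/-- Finite rooted trees in which every non-leaf vertex has `d` (ordered) children. -/
inductive DTree (d : ℕ) : Type
  | leaf : DTree d
  | node (c : Fin d → DTree d) : DTree d

namespace DTree

variable {d : ℕ}

/-- The number of leaves. -/
def numLeaves : DTree d → ℕ
  | leaf => 1
  | node c => ∑ i, (c i).numLeaves

/-- The number of leaves of the children strictly to the left of child `i`. -/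
def offset (c : Fin d → DTree d) (i : Fin d) : ℕ :=
  ∑ j ∈ Finset.Iio i, (c j).numLeaves

/-- Add a `d`-ary caret to the `k`-th leaf. Leaves are numbered from left to right, starting at `0`.
If there is no `k`-th leaf, i.e. `T.numLeaves ≤ k`, the tree is left unchanged. -/
def addCaret : DTree d → ℕ → DTree d
  | leaf, k => if k = 0 then node (fun _ => leaf) else leaf
  | node c, k => node fun i =>
      if offset c i ≤ k then (c i).addCaret (k - offset c i) else c i

/-- Auxiliary order on trees: `T.Le U` if `T` is a rooted subtree of `U`. -/
def Le : DTree d → DTree d → Prop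
  | leaf, _ => True
  | node _, leaf => False
  | node c, node e => ∀ i, (c i).Le (e i)

theorem Le.refl (T : DTree d) : T.Le T := by
  induction T with
  | leaf => trivial
  | node c ih => exact ih

theorem Le.trans {T U V : DTree d} (h₁ : T.Le U) (h₂ : U.Le V) : T.Le V := by
  induction T generalizing U V with
  | leaf => trivial
  | node c ih =>
    cases U with
    | leaf => exact h₁.elim
    | node e =>
      cases V with
      | leaf => exact h₂.elim
      | node f => exact fun i => ih i (h₁ i) (h₂ i)

theorem exists_upper (T U : DTree d) : ∃ V : DTree d, T.Le V ∧ U.Le V := by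
  induction T generalizing U with
  | leaf => exact ⟨U, trivial, Le.refl U⟩
  | node c ih =>
    cases U with
    | leaf => exact ⟨node c, Le.refl _, trivial⟩
    | node e =>
      choose f hf using fun i => ih i (e i)
      exact ⟨node f, fun i => (hf i).1, fun i => (hf i).2⟩

theorem offset_add_le (c : Fin d → DTree d) {i j : Fin d} (h : i < j) :
    offset c i + (c i).numLeaves ≤ offset c j := by
  unfold offset
  rw [add_comm, ← Finset.sum_insert (f := fun j => (c j).numLeaves) (by simp)]
  apply Finset.sum_le_sum_of_subset
  intro x hx
  simp only [Finset.mem_insert, Finset.mem_Iio] at hx ⊢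
  rcases hx with rfl | hx
  · exact h
  · exact hx.trans h

theorem offset_add_le_numLeaves (c : Fin d → DTree d) (i : Fin d) :
    offset c i + (c i).numLeaves ≤ (node c).numLeaves := by
  unfold offset
  rw [add_comm, ← Finset.sum_insert (f := fun j => (c j).numLeaves) (by simp)]
  exact Finset.sum_le_sum_of_subset (Finset.subset_univ _)

/-- Every leaf of `node c` lies in one of the children. -/
theorem exists_block (c : Fin d → DTree d) {k : ℕ} (hk : k < (node c).numLeaves) :
    ∃ i, offset c i ≤ k ∧ k < offset c i + (c i).numLeaves := by
  by_contra! H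
  have key : ∀ m (hm : m ≤ d), ∑ j with j.val < m, (c j).numLeaves ≤ k := by
    intro m
    induction m with
    | zero => intro _; simp
    | succ m ih =>
      intro hm
      have h₁ := ih (by omega)
      have h₂ : (Finset.univ.filter fun j : Fin d => j.val < m) = Finset.Iio ⟨m, hm⟩ := by
        ext x; simp [Fin.lt_def]
      have h₃ : (Finset.univ.filter fun j : Fin d => j.val < m + 1)
          = insert ⟨m, hm⟩ (Finset.Iio ⟨m, hm⟩) := by
        ext x
        simp only [Finset.mem_filter, Finset.mem_univ, true_and, Finset.mem_insert,
          Finset.mem_Iio, Fin.lt_def, Fin.ext_iff]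
        omega
      rw [h₂] at h₁
      rw [h₃, Finset.sum_insert (by simp), add_comm]
      exact H ⟨m, hm⟩ h₁
  have := key d le_rfl
  simp only [Fin.is_lt, Finset.filter_true] at this
  simp only [numLeaves] at hk
  omega

theorem addCaret_of_le (T : DTree d) {k : ℕ} (hk : T.numLeaves ≤ k) : T.addCaret k = T := by
  induction T generalizing k with
  | leaf => simp only [numLeaves] at hk; simp [addCaret]; omega
  | node c ih =>
    simp only [addCaret, node.injEq]
    funext i
    have := offset_add_le_numLeaves c i
    rw [ih i (by omega)]
    simp

/-- Adding a caret inside child `i` changes child `i` only. -/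
theorem addCaret_node (c : Fin d → DTree d) {i : Fin d} {k : ℕ} (h₁ : offset c i ≤ k)
    (h₂ : k < offset c i + (c i).numLeaves) :
    (node c).addCaret k = node (Function.update c i ((c i).addCaret (k - offset c i))) := by
  simp only [addCaret, node.injEq]
  funext j
  rcases lt_trichotomy j i with h | rfl | h
  · rw [Function.update_of_ne h.ne]
    have := offset_add_le c h
    rw [addCaret_of_le _ (by omega)]
    simp
  · simp [h₁]
  · rw [Function.update_of_ne h.ne']
    have := offset_add_le c h
    rw [if_neg (by omega)]

theorem numLeaves_addCaret (hd : 1 ≤ d) (T : DTree d) {k : ℕ} (hk : k < T.numLeaves) :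
    (T.addCaret k).numLeaves = T.numLeaves + (d - 1) := by
  induction T generalizing k with
  | leaf =>
    simp only [numLeaves] at hk
    obtain rfl : k = 0 := by omega
    simp [addCaret, numLeaves]; omega
  | node c ih =>
    obtain ⟨i, h₁, h₂⟩ := exists_block c hk
    rw [addCaret_node c h₁ h₂]
    have := ih i (k := k - offset c i) (by omega)
    simp only [numLeaves]
    rw [← Finset.add_sum_erase _ _ (Finset.mem_univ i),
      ← Finset.add_sum_erase (a := i) _ (fun i => (c i).numLeaves) (Finset.mem_univ i)]
    have h : ∑ x ∈ Finset.univ.erase i,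
        (Function.update c i ((c i).addCaret (k - offset c i)) x).numLeaves
        = ∑ x ∈ Finset.univ.erase i, (c x).numLeaves :=
      Finset.sum_congr rfl fun x hx => by
        rw [Function.update_of_ne (Finset.ne_of_mem_erase hx)]
    rw [h, Function.update_self, this]
    omega

theorem offset_update_of_le (c : Fin d → DTree d) {i j : Fin d} (h : j ≤ i) (T : DTree d) :
    offset (Function.update c i T) j = offset c j := by
  refine Finset.sum_congr rfl fun x hx => ?_
  rw [Function.update_of_ne ((Finset.mem_Iio.1 hx).trans_le h).ne]

theorem offset_update_of_lt (c : Fin d → DTree d) {i j : Fin d} (h : i < j) (T : DTree d) :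
    offset (Function.update c i T) j + (c i).numLeaves = offset c j + T.numLeaves := by
  unfold offset
  have hi : i ∈ Finset.Iio j := Finset.mem_Iio.2 h
  rw [← Finset.add_sum_erase _ _ hi,
    ← Finset.add_sum_erase (a := i) _ (fun i => (c i).numLeaves) hi]
  have h : ∑ x ∈ (Finset.Iio j).erase i, (Function.update c i T x).numLeaves
      = ∑ x ∈ (Finset.Iio j).erase i, (c x).numLeaves :=
    Finset.sum_congr rfl fun x hx => by
      rw [Function.update_of_ne (Finset.ne_of_mem_erase hx)]
  rw [h, Function.update_self]
  omega

theorem addCaret_comm (hd : 1 ≤ d) (T : DTree d) {k l : ℕ} (hkl : k < l) (hl : l < T.numLeaves) :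
    (T.addCaret l).addCaret k = (T.addCaret k).addCaret (l + (d - 1)) := by
  induction T generalizing k l with
  | leaf => simp only [numLeaves] at hl; omega
  | node c ih =>
    obtain ⟨j, hj₁, hj₂⟩ := exists_block c hl
    obtain ⟨i, hi₁, hi₂⟩ := exists_block c (hkl.trans hl)
    have hij : i ≤ j := by
      by_contra! h
      have := offset_add_le c h
      omega
    have hni := numLeaves_addCaret hd (c i) (k := k - offset c i) (by omega)
    rw [addCaret_node c hj₁ hj₂, addCaret_node c hi₁ hi₂]
    have e₁ : ∀ T, offset (Function.update c j T) i = offset c i := offset_update_of_le c hij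
    rcases hij.eq_or_lt with rfl | hij
    · have e₃ : ∀ T, offset (Function.update c i T) i = offset c i :=
        offset_update_of_le c le_rfl
      have hnj := numLeaves_addCaret hd (c i) (k := l - offset c i) (by omega)
      rw [addCaret_node (i := i) _ (by rw [e₃]; exact hi₁)
          (by rw [e₃, Function.update_self]; omega),
        addCaret_node (i := i) _ (by rw [e₃]; omega)
          (by rw [e₃, Function.update_self]; omega), e₃, e₃]
      simp only [Function.update_self, Function.update_idem]
      rw [ih i (k := k - offset c i) (l := l - offset c i) (by omega) (by omega)]
      congr 4
      omega
    · have e₂ := offset_update_of_lt c hij ((c i).addCaret (k - offset c i))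
      have e₄ : offset (Function.update c i ((c i).addCaret (k - offset c i))) j
          = offset c j + (d - 1) := by omega
      rw [addCaret_node (i := i) _ (by rw [e₁]; exact hi₁)
          (by rw [e₁, Function.update_of_ne hij.ne]; exact hi₂),
        addCaret_node (i := j) _ (by rw [e₄]; omega)
          (by rw [e₄, Function.update_of_ne hij.ne']; omega), e₁, e₄,
        Function.update_of_ne hij.ne, Function.update_of_ne hij.ne',
        Function.update_comm hij.ne]
      congr 4
      omega

theorem le_addCaret (T : DTree d) (k : ℕ) : T.Le (T.addCaret k) := by
  induction T generalizing k with
  | leaf => trivial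
  | node c ih =>
    intro i
    show (c i).Le (if _ then _ else _)
    split
    · exact ih i _
    · exact Le.refl _

theorem exists_addCaret_le {T U : DTree d} (h : T.Le U) (hne : T ≠ U) :
    ∃ k < T.numLeaves, (T.addCaret k).Le U := by
  induction T generalizing U with
  | leaf =>
    cases U with
    | leaf => exact (hne rfl).elim
    | node e =>
      refine ⟨0, by simp [numLeaves], ?_⟩
      simp only [addCaret, if_true]
      exact fun i => trivial
  | node c ih =>
    cases U with
    | leaf => exact h.elim
    | node e =>
      have : ∃ i, c i ≠ e i := by
        by_contra! H
        exact hne (congrArg node (funext H))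
      obtain ⟨i, hi⟩ := this
      obtain ⟨k, hk, hle⟩ := ih i (h i) hi
      have := offset_add_le_numLeaves c i
      refine ⟨offset c i + k, by omega, ?_⟩
      rw [addCaret_node c (i := i) (by omega) (by omega)]
      intro j
      by_cases hj : j = i
      · subst hj; simpa using hle
      · rw [Function.update_of_ne hj]; exact h j

theorem addCaret_addCaret_le (hd : 1 ≤ d) {T U : DTree d} {k l : ℕ} (hkl : k < l)
    (hk : (T.addCaret k).Le U) (hl : (T.addCaret l).Le U) :
    ((T.addCaret l).addCaret k).Le U := by
  by_cases hlT : l < T.numLeaves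
  swap
  · rwa [addCaret_of_le T (k := l) (by omega)]
  induction T generalizing U k l with
  | leaf => simp only [numLeaves] at hlT; omega
  | node c ih =>
    cases U with
    | leaf => exact hk.elim
    | node e =>
    obtain ⟨j, hj₁, hj₂⟩ := exists_block c hlT
    obtain ⟨i, hi₁, hi₂⟩ := exists_block c (hkl.trans hlT)
    have hij : i ≤ j := by
      by_contra! h
      have := offset_add_le c h
      omega
    rw [addCaret_node c hj₁ hj₂] at hl ⊢
    rw [addCaret_node c hi₁ hi₂] at hk
    have e₁ : ∀ T, offset (Function.update c j T) i = offset c i := offset_update_of_le c hij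
    have hki := hk i
    have hlj := hl j
    rw [Function.update_self] at hki hlj
    rcases hij.eq_or_lt with rfl | hij
    · have hnj := numLeaves_addCaret hd (c i) (k := l - offset c i) (by omega)
      rw [addCaret_node (i := i) _ (by rw [e₁]; exact hi₁)
          (by rw [e₁, Function.update_self]; omega), e₁]
      simp only [Function.update_self, Function.update_idem]
      intro x
      by_cases hx : x = i
      · subst hx
        rw [Function.update_self]
        exact ih x (by omega) hki hlj (by omega)
      · have := hk x
        rw [Function.update_of_ne hx] at this ⊢
        exact this
    · rw [addCaret_node (i := i) _ (by rw [e₁]; exact hi₁)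
          (by rw [e₁, Function.update_of_ne hij.ne]; exact hi₂), e₁]
      intro x
      by_cases hx : x = i
      · subst hx
        rw [Function.update_self, Function.update_of_ne hij.ne]
        exact hki
      · rw [Function.update_of_ne hx]
        exact hl x

end DTree

/-! ### Cloning systems -/

/-- The function underlying `symClone`, see there. -/
def symCloneFun (d : ℕ) {n : ℕ} (σ : Equiv.Perm (Fin n)) (k : Fin n) (i : Fin (n + (d - 1))) :
    Fin (n + (d - 1)) :=
  if _h : i.val < k.val then
    if σ ⟨i.val, by omega⟩ < σ k then Fin.castAdd (d - 1) (σ ⟨i.val, by omega⟩)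
    else Fin.addNat (σ ⟨i.val, by omega⟩) (d - 1)
  else if _h' : i.val ≤ k.val + (d - 1) then ⟨(σ k).val + (i.val - k.val), by omega⟩
  else
    if σ ⟨i.val - (d - 1), by omega⟩ < σ k then Fin.castAdd (d - 1) (σ ⟨i.val - (d - 1), by omega⟩)
    else Fin.addNat (σ ⟨i.val - (d - 1), by omega⟩) (d - 1)

theorem symCloneFun_injective (d : ℕ) {n : ℕ} (σ : Equiv.Perm (Fin n)) (k : Fin n) :
    Function.Injective (symCloneFun d σ k) := by
  have key : ∀ a b : Fin n, (σ a).val = (σ b).val → a.val = b.val := fun a b h => by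
    rw [σ.injective (Fin.ext h)]
  intro i j h
  have h := congrArg Fin.val h
  unfold symCloneFun at h
  simp only [Fin.lt_def] at h
  ext
  split_ifs at h <;> simp only [Fin.val_castAdd, Fin.val_addNat] at h <;> grind

/-- The standard `d`-ary cloning map of the symmetric groups (points are numbered from `0`).
`symClone d σ k` is obtained from `σ` by replacing the point `k` of the domain by the block of the
`d` points `k, …, k + (d - 1)`, replacing the point `σ k` of the codomain by the block
`σ k, …, σ k + (d - 1)`, mapping the one block onto the other preserving the order, and mapping the
remaining points as `σ` does (shifted by `d - 1` if they lie to the right of the block). -/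
noncomputable def symClone (d : ℕ) {n : ℕ} (σ : Equiv.Perm (Fin n)) (k : Fin n) :
    Equiv.Perm (Fin (n + (d - 1))) :=
  Equiv.ofBijective (symCloneFun d σ k) (Finite.injective_iff_bijective.1 (symCloneFun_injective d σ k))

/-- A `d`-ary cloning system on the family of groups `(G n)_{n ≥ 1}` (the group `G 0` plays no role).
The points `1, …, n` are `0, …, n - 1` here. The image `(g)κ_k^n` is written `κ n k g`. -/
structure CloningSystem (d : ℕ) (G : ℕ → Type*) [∀ n, Group (G n)] where
  two_le : 2 ≤ d
  /-- the representation maps -/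
  ρ : ∀ n, G n →* Equiv.Perm (Fin n)
  /-- the cloning maps -/
  κ : ∀ n, Fin n → G n → G (n + (d - 1))
  κ_injective : ∀ n k, Function.Injective (κ n k)
  /-- cloning a product -/
  κ_mul : ∀ (n : ℕ) (k : Fin n) (g h : G n), κ n k (g * h) = κ n (ρ n h k) g * κ n k h
  /-- product of clonings -/
  κ_κ : ∀ (n : ℕ) (k l : Fin n), k < l → ∀ g : G n,
    κ (n + (d - 1)) (Fin.castAdd (d - 1) k) (κ n l g)
      = κ (n + (d - 1)) (Fin.addNat l (d - 1)) (κ n k g)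
  /-- compatibility -/
  ρ_κ : ∀ (n : ℕ) (k : Fin n) (g : G n) (i : Fin (n + (d - 1))),
    (i.val < k.val ∨ k.val + (d - 1) < i.val) → ρ (n + (d - 1)) (κ n k g) i = symClone d (ρ n g) k i

namespace CloningSystem

variable {d : ℕ} {G : ℕ → Type*} [∀ n, Group (G n)]

/-- A cloning system is fully compatible if the compatibility condition holds for all `i`. -/
def FullyCompatible (C : CloningSystem d G) : Prop :=
  ∀ (n : ℕ) (k : Fin n) (g : G n) (i : Fin (n + (d - 1))),
    C.ρ (n + (d - 1)) (C.κ n k g) i = symClone d (C.ρ n g) k i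

/-- The triples `(T₋, g, T₊)`, where `T₋` and `T₊` are trees with `n` leaves and `g ∈ G n`. -/
@[ext]
structure Triple (d : ℕ) (G : ℕ → Type*) where
  n : ℕ
  neg : DTree d
  g : G n
  pos : DTree d
  neg_numLeaves : neg.numLeaves = n
  pos_numLeaves : pos.numLeaves = n

variable (C : CloningSystem d G)

/-- The expansion of `(T₋, g, T₊)` at `k`: the triple `(T₋', (g)κ_k^n, T₊')`, where `T₊'` is `T₊` with
a caret added to the `k`-th leaf and `T₋'` is `T₋` with a caret added to the `ρ_n(g)(k)`-th leaf. -/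
def expand (t : Triple d G) (k : Fin t.n) : Triple d G where
  n := t.n + (d - 1)
  neg := t.neg.addCaret (C.ρ t.n t.g k)
  g := C.κ t.n k t.g
  pos := t.pos.addCaret k
  neg_numLeaves := by
    have := C.two_le
    have := t.neg_numLeaves
    rw [DTree.numLeaves_addCaret (by omega) _ (by omega), this]
  pos_numLeaves := by
    have := C.two_le
    have := t.pos_numLeaves
    rw [DTree.numLeaves_addCaret (by omega) _ (by omega), this]

/-- `s` is the expansion of `t` at some `k`. -/
def Expansion (t s : Triple d G) : Prop := ∃ k, s = C.expand t k

/-- Two triples are equivalent if one can get from one to the other by finitely many expansions and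
reductions. -/
def tripleSetoid : Setoid (Triple d G) := Relation.EqvGen.setoid C.Expansion

/-- The Thompson-like group of a cloning system, as a set: the equivalence classes of triples. -/
def ThompsonLike : Type _ := Quotient C.tripleSetoid

/-- The equivalence class `[T₋, g, T₊]`. -/
def cls (t : Triple d G) : C.ThompsonLike := Quotient.mk C.tripleSetoid t

/-- Finite sequences of expansions. -/
def Expands : Triple d G → Triple d G → Prop := Relation.ReflTransGen C.Expansion

variable {C}

theorem exists_cls (x : C.ThompsonLike) : ∃ t, x = C.cls t :=
  (Quotient.exists_rep x).imp fun _ h => h.symm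

theorem cls_eq_of_expansion {t s : Triple d G} (h : C.Expansion t s) : C.cls t = C.cls s :=
  Quotient.sound (s := C.tripleSetoid) (Relation.EqvGen.rel _ _ h)

theorem cls_eq_of_expands {t s : Triple d G} (h : C.Expands t s) : C.cls t = C.cls s := by
  induction h with
  | refl => rfl
  | tail _ h ih => exact ih.trans (cls_eq_of_expansion h)

theorem κ_one (n : ℕ) (k : Fin n) : C.κ n k 1 = 1 := by
  have := C.κ_mul n k 1 1
  simpa using this

theorem κ_inv (n : ℕ) (k : Fin n) (g : G n) : C.κ n (C.ρ n g k) g⁻¹ = (C.κ n k g)⁻¹ := by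
  have := C.κ_mul n k g⁻¹ g
  rw [inv_mul_cancel, κ_one] at this
  exact eq_inv_of_mul_eq_one_left this.symm

/-- Expansions at two different leaves commute. -/
theorem expand_comm (t : Triple d G) {k l : Fin t.n} (h : k < l) :
    C.expand (C.expand t l) (Fin.castAdd (d - 1) k)
      = C.expand (C.expand t k) (Fin.addNat l (d - 1)) := by
  have hd := C.two_le
  have e₁ : C.ρ _ (C.κ t.n l t.g) (Fin.castAdd (d - 1) k) = symClone d (C.ρ t.n t.g) l _ :=
    C.ρ_κ t.n l t.g _ (Or.inl h)
  have e₂ : C.ρ _ (C.κ t.n k t.g) (Fin.addNat l (d - 1)) = symClone d (C.ρ t.n t.g) k _ :=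
    C.ρ_κ t.n k t.g _ (Or.inr (by simpa using h))
  have hlt : k.val < l.val := h
  have hneg : ((C.expand (C.expand t l) (Fin.castAdd (d - 1) k))).neg
      = (C.expand (C.expand t k) (Fin.addNat l (d - 1))).neg := by
    change (t.neg.addCaret (C.ρ t.n t.g l).val).addCaret
        (C.ρ (t.n + (d - 1)) (C.κ t.n l t.g) (Fin.castAdd (d - 1) k)).val
      = (t.neg.addCaret (C.ρ t.n t.g k).val).addCaret
        (C.ρ (t.n + (d - 1)) (C.κ t.n k t.g) (Fin.addNat l (d - 1))).val
    rw [e₁, e₂]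
    have hne : C.ρ t.n t.g k ≠ C.ρ t.n t.g l := fun h' => h.ne ((C.ρ t.n t.g).injective h')
    have f₁ : (symClone d (C.ρ t.n t.g) l (Fin.castAdd (d - 1) k)).val
        = if C.ρ t.n t.g k < C.ρ t.n t.g l then (C.ρ t.n t.g k).val
          else (C.ρ t.n t.g k).val + (d - 1) := by
      simp only [symClone, Equiv.ofBijective_apply, symCloneFun, Fin.val_castAdd, hlt, dite_true]
      split_ifs <;> rfl
    have f₂ : (symClone d (C.ρ t.n t.g) k (Fin.addNat l (d - 1))).val
        = if C.ρ t.n t.g l < C.ρ t.n t.g k then (C.ρ t.n t.g l).val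
          else (C.ρ t.n t.g l).val + (d - 1) := by
      have h₁ : ¬ (l.val + (d - 1) < k.val) := by omega
      have h₂ : ¬ (l.val + (d - 1) ≤ k.val + (d - 1)) := by omega
      simp only [symClone, Equiv.ofBijective_apply, symCloneFun, Fin.val_addNat, h₁, h₂, dite_false,
        Nat.add_sub_cancel, Fin.eta]
      split_ifs <;> rfl
    rw [f₁, f₂]
    have hn := t.neg_numLeaves
    rcases lt_or_gt_of_ne hne with h' | h'
    · rw [if_pos h', if_neg h'.not_gt]
      exact DTree.addCaret_comm (by omega) _ h' (by omega)
    · rw [if_neg h'.not_gt, if_pos h']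
      exact (DTree.addCaret_comm (by omega) _ h' (by omega)).symm
  have hpos : ((C.expand (C.expand t l) (Fin.castAdd (d - 1) k))).pos
      = (C.expand (C.expand t k) (Fin.addNat l (d - 1))).pos := by
    have hn := t.pos_numLeaves
    exact DTree.addCaret_comm (by omega) _ hlt (by omega)
  exact Triple.ext rfl hneg (heq_of_eq (C.κ_κ t.n k l h t.g)) hpos

/-- Equivalent triples have a common expansion. -/
theorem exists_common_expansion {t s : Triple d G} (h : C.cls t = C.cls s) :
    ∃ u, C.Expands t u ∧ C.Expands s u := by
  have h : Relation.EqvGen C.Expansion t s := Quotient.exact h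
  have key : ∀ a b c, C.Expansion a b → C.Expansion a c →
      ∃ u, Relation.ReflGen C.Expansion b u ∧ Relation.ReflTransGen C.Expansion c u := by
    rintro a _ _ ⟨k, rfl⟩ ⟨l, rfl⟩
    rcases lt_trichotomy k l with h | rfl | h
    · exact ⟨_, .single ⟨_, rfl⟩, .single ⟨_, (expand_comm a h).symm⟩⟩
    · exact ⟨_, .refl, .refl⟩
    · exact ⟨_, .single ⟨_, rfl⟩, .single ⟨_, expand_comm a h⟩⟩
  have hE := Relation.equivalence_join_reflTransGen key
  exact hE.eqvGen_iff.1 (Relation.EqvGen.mono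
    (fun a b hab => ⟨b, .single hab, .refl⟩) _ _ h)

theorem Expands.pos_le {t s : Triple d G} (h : C.Expands t s) : t.pos.Le s.pos := by
  induction h with
  | refl => exact DTree.Le.refl _
  | tail _ h ih =>
    obtain ⟨k, rfl⟩ := h
    exact ih.trans (DTree.le_addCaret _ _)

theorem Expands.neg_le {t s : Triple d G} (h : C.Expands t s) : t.neg.Le s.neg := by
  induction h with
  | refl => exact DTree.Le.refl _
  | tail _ h ih =>
    obtain ⟨k, rfl⟩ := h
    exact ih.trans (DTree.le_addCaret _ _)

end CloningSystem

theorem DTree.Le.numLeaves_le {d : ℕ} (hd : 1 ≤ d) {T U : DTree d} (h : T.Le U) :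
    T.numLeaves ≤ U.numLeaves := by
  induction T generalizing U with
  | leaf =>
    induction U with
    | leaf => exact le_rfl
    | node e ih =>
      have h₁ := ih ⟨0, hd⟩ trivial
      have h₂ := DTree.offset_add_le_numLeaves e ⟨0, hd⟩
      omega
  | node c ih =>
    cases U with
    | leaf => exact h.elim
    | node e => exact Finset.sum_le_sum fun i _ => ih i (h i)

namespace CloningSystem

variable {d : ℕ} {G : ℕ → Type*} [∀ n, Group (G n)] {C : CloningSystem d G}

/-- A triple can be expanded so that its last tree becomes any given larger tree. -/
theorem exists_expands_pos (t : Triple d G) {U : DTree d} (h : t.pos.Le U) :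
    ∃ s, C.Expands t s ∧ s.pos = U := by
  have hd := C.two_le
  induction hm : U.numLeaves - t.n using Nat.strong_induction_on generalizing t with
  | _ m ih =>
    by_cases hU : t.pos = U
    · exact ⟨t, .refl, hU⟩
    obtain ⟨k, hk, hle⟩ := DTree.exists_addCaret_le h hU
    rw [t.pos_numLeaves] at hk
    have h₁ := DTree.Le.numLeaves_le (by omega) hle
    rw [DTree.numLeaves_addCaret (by omega) _ (by rw [t.pos_numLeaves]; exact hk),
      t.pos_numLeaves] at h₁
    obtain ⟨s, hs, hsU⟩ := ih (U.numLeaves - (t.n + (d - 1))) (by omega)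
      (C.expand t ⟨k, hk⟩) hle rfl
    exact ⟨s, .head ⟨_, rfl⟩ hs, hsU⟩

/-- A triple can be expanded so that its first tree becomes any given larger tree. -/
theorem exists_expands_neg (t : Triple d G) {U : DTree d} (h : t.neg.Le U) :
    ∃ s, C.Expands t s ∧ s.neg = U := by
  have hd := C.two_le
  induction hm : U.numLeaves - t.n using Nat.strong_induction_on generalizing t with
  | _ m ih =>
    by_cases hU : t.neg = U
    · exact ⟨t, .refl, hU⟩
    obtain ⟨k, hk, hle⟩ := DTree.exists_addCaret_le h hU
    rw [t.neg_numLeaves] at hk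
    have h₁ := DTree.Le.numLeaves_le (by omega) hle
    rw [DTree.numLeaves_addCaret (by omega) _ (by rw [t.neg_numLeaves]; exact hk),
      t.neg_numLeaves] at h₁
    obtain ⟨s, hs, hsU⟩ := ih (U.numLeaves - (t.n + (d - 1))) (by omega)
      (C.expand t ((C.ρ t.n t.g).symm ⟨k, hk⟩)) (by simpa [expand] using hle) rfl
    exact ⟨s, .head ⟨_, rfl⟩ hs, hsU⟩

theorem Expands.eq_of_pos_eq {t s₁ s₂ : Triple d G} (h₁ : C.Expands t s₁) (h₂ : C.Expands t s₂)
    (h : s₁.pos = s₂.pos) : s₁ = s₂ := by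
  have hd := C.two_le
  have hlt : ∀ {t s : Triple d G} (k : Fin t.n), C.Expands (C.expand t k) s → t.n < s.n := by
    intro t s k hs
    have h := DTree.Le.numLeaves_le (by omega) hs.pos_le
    rw [(C.expand t k).pos_numLeaves, s.pos_numLeaves] at h
    have : (C.expand t k).n = t.n + (d - 1) := rfl
    omega
  have hn : s₁.n = s₂.n := by rw [← s₁.pos_numLeaves, ← s₂.pos_numLeaves, h]
  induction hm : s₁.n - t.n using Nat.strong_induction_on generalizing t s₁ s₂ with
  | _ m ih =>
    rcases Relation.ReflTransGen.cases_head h₁ with rfl | ⟨_, ⟨k, rfl⟩, h₁'⟩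
    · rcases Relation.ReflTransGen.cases_head h₂ with rfl | ⟨_, ⟨l, rfl⟩, h₂'⟩
      · rfl
      · have := hlt l h₂'
        omega
    · rcases Relation.ReflTransGen.cases_head h₂ with rfl | ⟨_, ⟨l, rfl⟩, h₂'⟩
      · have := hlt k h₁'
        omega
      have hk := hlt k h₁'
      have main : ∀ {k l : Fin t.n} {r₁ r₂ : Triple d G}, k < l → r₁.pos = r₂.pos →
          r₁.n = r₂.n → r₁.n = s₁.n → C.Expands (C.expand t k) r₁ →
          C.Expands (C.expand t l) r₂ → r₁ = r₂ := by
        intro k l r₁ r₂ hkl hr hrn hrs e₁ e₂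
        have hle : ((t.pos.addCaret l).addCaret k).Le r₁.pos :=
          DTree.addCaret_addCaret_le (by omega) hkl e₁.pos_le (hr ▸ e₂.pos_le)
        obtain ⟨r, hr', hrp⟩ := exists_expands_pos (C := C)
          (C.expand (C.expand t l) (Fin.castAdd (d - 1) k)) hle
        have hr'' := hr'
        rw [expand_comm t hkl] at hr''
        have hrn' : r.n = r₁.n := by rw [← r.pos_numLeaves, hrp, r₁.pos_numLeaves]
        have a₁ : r₁ = r := ih (r₁.n - (t.n + (d - 1))) (by omega) e₁
          (.head ⟨_, rfl⟩ hr'') hrp.symm hrn'.symm rfl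
        have a₂ : r₂ = r := ih (r₂.n - (t.n + (d - 1))) (by omega) e₂
          (.head ⟨_, rfl⟩ hr') (by rw [hrp, hr]) (by omega) rfl
        rw [a₁, a₂]
      rcases lt_trichotomy k l with hkl | rfl | hkl
      · exact main hkl h hn rfl h₁' h₂'
      · exact ih (s₁.n - (t.n + (d - 1))) (by omega) h₁' h₂' h hn rfl
      · exact (main hkl h.symm hn.symm hn.symm h₂' h₁').symm

/-- `(T₋, 1, T₊)` expands to triples of the same form. -/
theorem Expands.one {n : ℕ} {A : DTree d} (hA : A.numLeaves = n)
    {s : Triple d G} (h : C.Expands ⟨n, A, 1, A, hA, hA⟩ s) : s.g = 1 ∧ s.neg = s.pos := by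
  induction h with
  | refl => exact ⟨rfl, rfl⟩
  | tail _ h ih =>
    obtain ⟨k, rfl⟩ := h
    simp only [expand, ih.1, κ_one, map_one, ih.2, Equiv.Perm.coe_one, id_eq]
    exact ⟨rfl, trivial⟩

/-- An expansion of the right factor of a product can be matched by one of the left factor. -/
theorem Expands.mul {n : ℕ} {A B E : DTree d} {g h : G n} {hA : A.numLeaves = n}
    {hB : B.numLeaves = n} {hE : E.numLeaves = n} {s : Triple d G}
    (hs : C.Expands ⟨n, B, h, E, hB, hE⟩ s) :
    ∃ (A' : DTree d) (g' : G s.n) (hA' : A'.numLeaves = s.n),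
      C.Expands ⟨n, A, g, B, hA, hB⟩ ⟨s.n, A', g', s.neg, hA', s.neg_numLeaves⟩ ∧
      C.Expands ⟨n, A, g * h, E, hA, hE⟩ ⟨s.n, A', g' * s.g, s.pos, hA', s.pos_numLeaves⟩ := by
  induction hs with
  | refl => exact ⟨A, g, hA, .refl, .refl⟩
  | @tail s _ _ hstep ih =>
    obtain ⟨k, rfl⟩ := hstep
    obtain ⟨A', g', hA', h₁, h₂⟩ := ih
    refine ⟨A'.addCaret (C.ρ s.n g' (C.ρ s.n s.g k)), C.κ s.n (C.ρ s.n s.g k) g',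
      (C.expand ⟨s.n, A', g', s.neg, hA', s.neg_numLeaves⟩ (C.ρ s.n s.g k)).neg_numLeaves,
      .tail h₁ ⟨C.ρ s.n s.g k, rfl⟩, .tail h₂ ⟨k, ?_⟩⟩
    refine Triple.ext rfl ?_ (heq_of_eq ?_) rfl
    · simp [expand, map_mul]
    · exact (C.κ_mul s.n k g' s.g).symm

/-- `z` is the product of `x` and `y`: there are representatives `x = [T₋, g, U]`, `y = [U, h, U₊]`
and `z = [T₋, gh, U₊]`. -/
def IsProd (x y z : C.ThompsonLike) : Prop :=
  ∃ (n : ℕ) (A B E : DTree d) (g h : G n) (hA : A.numLeaves = n) (hB : B.numLeaves = n)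
    (hE : E.numLeaves = n),
    x = C.cls ⟨n, A, g, B, hA, hB⟩ ∧ y = C.cls ⟨n, B, h, E, hB, hE⟩ ∧
      z = C.cls ⟨n, A, g * h, E, hA, hE⟩

theorem exists_isProd (x y : C.ThompsonLike) : ∃ z, IsProd x y z := by
  obtain ⟨t, rfl⟩ := exists_cls x
  obtain ⟨s, rfl⟩ := exists_cls y
  obtain ⟨V, h₁, h₂⟩ := DTree.exists_upper t.pos s.neg
  obtain ⟨t', ht, ht'⟩ := exists_expands_pos (C := C) t h₁
  obtain ⟨s', hs, hs'⟩ := exists_expands_neg (C := C) s h₂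
  have e₁ := cls_eq_of_expands ht
  have e₂ := cls_eq_of_expands hs
  obtain ⟨n, A, g, B, hA, hB⟩ := t'
  obtain ⟨m, B', h, E, hB', hE⟩ := s'
  obtain rfl : B = V := ht'
  obtain rfl : B' = B := hs'
  obtain rfl : n = m := hB.symm.trans hB'
  exact ⟨_, n, A, _, E, g, h, hA, hB, hE, e₁, e₂, rfl⟩

theorem IsProd.unique {x y z₁ z₂ : C.ThompsonLike} (p₁ : IsProd x y z₁) (p₂ : IsProd x y z₂) :
    z₁ = z₂ := by
  obtain ⟨n, A, B, E, g, h, hA, hB, hE, x₁, y₁, rfl⟩ := p₁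
  obtain ⟨n', A', B', E', g', h', hA', hB', hE', x₂, y₂, rfl⟩ := p₂
  obtain ⟨t, ht, ht'⟩ := exists_common_expansion (x₁.symm.trans x₂)
  obtain ⟨s, hs, hs'⟩ := exists_common_expansion (y₁.symm.trans y₂)
  obtain ⟨V, v₁, v₂⟩ := DTree.exists_upper t.pos s.neg
  obtain ⟨u, hu, huV⟩ := exists_expands_pos (C := C) t v₁
  obtain ⟨w, hw, hwV⟩ := exists_expands_neg (C := C) s v₂
  obtain ⟨A₁, g₁, hA₁, a₁, b₁⟩ := Expands.mul (A := A) (g := g) (hA := hA) (hs.trans hw)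
  obtain ⟨A₂, g₂, hA₂, a₂, b₂⟩ := Expands.mul (A := A') (g := g') (hA := hA') (hs'.trans hw)
  have c₁ := Expands.eq_of_pos_eq a₁ (ht.trans hu) (hwV.trans huV.symm)
  have c₂ := Expands.eq_of_pos_eq a₂ (ht'.trans hu) (hwV.trans huV.symm)
  have c := c₁.trans c₂.symm
  simp only [Triple.mk.injEq, heq_eq_eq, true_and, and_true] at c
  obtain ⟨rfl, rfl⟩ := c
  exact (cls_eq_of_expands b₁).trans (cls_eq_of_expands b₂).symm

noncomputable instance : Mul C.ThompsonLike := ⟨fun x y => (exists_isProd x y).choose⟩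

/-- The product is determined by `[T₋, g, U][U, h, U₊] = [T₋, gh, U₊]`. -/
theorem cls_mul_cls {n : ℕ} {A B E : DTree d} (g h : G n) (hA : A.numLeaves = n)
    (hB : B.numLeaves = n) (hE : E.numLeaves = n) :
    C.cls ⟨n, A, g, B, hA, hB⟩ * C.cls ⟨n, B, h, E, hB, hE⟩ = C.cls ⟨n, A, g * h, E, hA, hE⟩ :=
  (exists_isProd _ _).choose_spec.unique ⟨n, A, B, E, g, h, hA, hB, hE, rfl, rfl, rfl⟩

/-- The identity is `[T, 1, T]` for the tree `T` with one leaf. -/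
instance : One C.ThompsonLike := ⟨C.cls ⟨1, .leaf, 1, .leaf, rfl, rfl⟩⟩

/-- The identity is `[T, 1, T]` for any tree `T`. -/
theorem cls_one {n : ℕ} (A : DTree d) (hA : A.numLeaves = n) :
    C.cls ⟨n, A, 1, A, hA, hA⟩ = 1 := by
  obtain ⟨s, hs, rfl⟩ := exists_expands_pos (C := C) (U := A)
    ⟨1, .leaf, 1, .leaf, rfl, rfl⟩ trivial
  obtain ⟨h₁, h₂⟩ := Expands.one (A := .leaf) rfl hs
  refine Eq.trans ?_ (cls_eq_of_expands hs).symm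
  obtain ⟨m, A', g, B, hA', hB⟩ := s
  obtain rfl : m = n := hB.symm.trans hA
  obtain rfl : g = 1 := h₁
  obtain rfl : A' = B := h₂
  rfl

/-- The inverse of `[T₋, g, T₊]` is `[T₊, g⁻¹, T₋]`. -/
instance : Inv C.ThompsonLike :=
  ⟨Quot.lift (fun t => C.cls ⟨t.n, t.pos, t.g⁻¹, t.neg, t.pos_numLeaves, t.neg_numLeaves⟩) <| by
    intro t s h
    induction h with
    | refl => rfl
    | symm _ _ _ ih => exact ih.symm
    | trans _ _ _ _ _ ih₁ ih₂ => exact ih₁.trans ih₂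
    | rel t s h =>
      obtain ⟨k, rfl⟩ := h
      refine cls_eq_of_expansion ⟨C.ρ t.n t.g k, Triple.ext rfl ?_ (heq_of_eq ?_) rfl⟩
      · simp [expand]
      · exact (κ_inv t.n k t.g).symm⟩

/-- The group structure on the equivalence classes of triples. -/
noncomputable instance : Group C.ThompsonLike :=
  Group.ofLeftAxioms
    (by
      intro x y z
      obtain ⟨z₀, n, B, E, E', h, k, hB, hE, hE', rfl, rfl, -⟩ := exists_isProd y z
      obtain ⟨t, rfl⟩ := exists_cls x
      obtain ⟨V, v₁, v₂⟩ := DTree.exists_upper t.pos B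
      obtain ⟨t', ht, htV⟩ := exists_expands_pos (C := C) t v₁
      obtain ⟨s', hs, hsV⟩ := exists_expands_neg (C := C) ⟨n, B, h, E, hB, hE⟩ v₂
      obtain ⟨r', hr, hrV⟩ := exists_expands_neg (C := C) ⟨n, E, k, E', hE, hE'⟩ hs.pos_le
      rw [cls_eq_of_expands ht, cls_eq_of_expands hs, cls_eq_of_expands hr]
      clear ht hs hr v₁ v₂
      obtain ⟨m₁, T₁, g₁, T₂, p₁, p₂⟩ := t'
      obtain ⟨m₂, T₃, g₂, T₄, p₃, p₄⟩ := s'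
      obtain ⟨m₃, T₅, g₃, T₆, p₅, p₆⟩ := r'
      obtain rfl : T₂ = V := htV
      obtain rfl : T₃ = T₂ := hsV
      obtain rfl : T₅ = T₄ := hrV
      obtain rfl : m₁ = m₂ := p₂.symm.trans p₃
      obtain rfl : m₁ = m₃ := p₄.symm.trans p₅
      rw [cls_mul_cls, cls_mul_cls, cls_mul_cls, cls_mul_cls, mul_assoc])
    (by
      intro x
      obtain ⟨t, rfl⟩ := exists_cls x
      rw [← cls_one t.neg t.neg_numLeaves]
      exact (cls_mul_cls 1 t.g _ _ _).trans (by simp only [one_mul]))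
    (by
      intro x
      obtain ⟨t, rfl⟩ := exists_cls x
      exact (cls_mul_cls t.g⁻¹ t.g _ _ _).trans (by
        simp only [inv_mul_cancel]; exact cls_one _ _))

end CloningSystem

/-! The group acts on the Cantor set of infinite words over `Fin d`: a triple `(T₋, g, T₊)` sends a
word running through the `k`-th leaf of `T₊` to the word running through the `ρ_n(g)(k)`-th leaf of
`T₋` with the same remainder. Full compatibility is what makes this invariant under expansion. The
proof splits according to whether `x ≠ 1` acts trivially.

If `x` moves some word, it carries a whole cone, the set of words with some prefix `q`, off itself
(`exists_cone_of_ne`). There is an element `f` supported on that cone with `q a t ↦ q a a t` for a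
letter `a` (`exists_supported_on_cone`). The conjugates `f ^ i * x * (f ^ i)⁻¹` are pairwise
distinct. Otherwise some positive power of `f` commutes with `x`; applied to a word `p` of the cone
whose image `x p` lies outside it, this gives that the power fixes `p`, which fails for `p = q a b b
…` with `b ≠ a`. This case needs nothing from the groups `G n`.

If `x` acts trivially, every word leaves `T₋` and `T₊` with the same remainder, which forces `T₋ =
T₊`. So `x` is the image of some `g ≠ 1` under the homomorphism `g ↦ [T, g, T]` from `G n`.
Injectivity of the cloning maps makes this an embedding, and the infinite conjugacy class of `g`
maps injectively into that of `x`. -/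

/-! ### Infinite words running through trees -/

namespace DTree

variable {d : ℕ}

/-- The index of the leaf of a tree at which an infinite word leaves the tree, together with the
remaining part of the word. -/
def parse : DTree d → Stream' (Fin d) → ℕ × Stream' (Fin d)
  | leaf, s => (0, s)
  | node c, s => (offset c s.head + ((c s.head).parse s.tail).1, ((c s.head).parse s.tail).2)

theorem parse_fst_lt (T : DTree d) (s : Stream' (Fin d)) : (T.parse s).1 < T.numLeaves := by
  induction T generalizing s with
  | leaf => simp [parse, numLeaves]
  | node c ih =>
    have h₁ := offset_add_le_numLeaves c s.head
    have h₂ := ih s.head s.tail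
    simp only [parse]
    omega

theorem eq_of_mem_blocks (c : Fin d → DTree d) {i j : Fin d} {k : ℕ}
    (hi₁ : offset c i ≤ k) (hi₂ : k < offset c i + (c i).numLeaves)
    (hj₁ : offset c j ≤ k) (hj₂ : k < offset c j + (c j).numLeaves) : i = j := by
  rcases lt_trichotomy i j with h | h | h
  · have := offset_add_le c h
    omega
  · exact h
  · have := offset_add_le c h
    omega

/-- The leaves below different children have disjoint ranges of numbers, so the leaf number recovers
the prefix letter by letter; the remainder supplies the rest of the word. -/
theorem parse_injective (T : DTree d) : Function.Injective T.parse := by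
  induction T with
  | leaf => intro s s' h; simpa [parse] using h
  | node c ih =>
    intro s s' h
    simp only [parse, Prod.mk.injEq] at h
    obtain ⟨h₁, h₂⟩ := h
    have l₁ := parse_fst_lt (c s.head) s.tail
    have l₂ := parse_fst_lt (c s'.head) s'.tail
    have hh : s.head = s'.head :=
      eq_of_mem_blocks c (k := offset c s.head + ((c s.head).parse s.tail).1)
        (Nat.le_add_right _ _) (by omega) (by omega) (by omega)
    rw [← hh] at h₁ h₂
    have ht : s.tail = s'.tail := ih s.head (Prod.ext (by omega) h₂)
    rw [← Stream'.eta s, ← Stream'.eta s', hh, ht]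

theorem exists_parse_eq (T : DTree d) {k : ℕ} (hk : k < T.numLeaves) (t : Stream' (Fin d)) :
    ∃ s, T.parse s = (k, t) := by
  induction T generalizing k with
  | leaf =>
    simp only [numLeaves] at hk
    exact ⟨t, by rw [Nat.lt_one_iff.1 hk]; rfl⟩
  | node c ih =>
    obtain ⟨i, h₁, h₂⟩ := exists_block c hk
    obtain ⟨s, hs⟩ := ih i (k := k - offset c i) (by omega)
    refine ⟨Stream'.cons i s, ?_⟩
    simp only [parse, Stream'.head_cons, Stream'.tail_cons, hs, Prod.mk.injEq, and_true]
    omega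

/-- The new caret replaces one leaf by `d`: leaves to its left keep their numbers, leaves to its
right shift by `d - 1`, and a word through leaf `k` spends one more letter to choose a child of the
caret. These are the same three cases as in `symCloneFun`. -/
theorem parse_addCaret (hd : 1 ≤ d) (T : DTree d) {k : ℕ} (hk : k < T.numLeaves)
    {s w : Stream' (Fin d)} {j : ℕ} (hs : T.parse s = (j, w)) :
    (T.addCaret k).parse s =
      if j < k then (j, w) else if j = k then (k + w.head.val, w.tail) else (j + (d - 1), w) := by
  induction T generalizing k j s with
  | leaf =>
    simp only [numLeaves] at hk
    obtain rfl : k = 0 := by omega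
    simp only [parse, Prod.mk.injEq] at hs
    obtain ⟨rfl, rfl⟩ := hs
    simp [addCaret, parse, offset, numLeaves]
  | node c ih =>
    obtain ⟨i, h₁, h₂⟩ := exists_block c hk
    rw [addCaret_node c h₁ h₂]
    simp only [parse, Prod.mk.injEq] at hs ⊢
    have l := parse_fst_lt (c s.head) s.tail
    obtain ⟨rfl, rfl⟩ := hs
    rcases lt_trichotomy s.head i with h | h | h
    · have := offset_add_le c h
      rw [offset_update_of_le c h.le, Function.update_of_ne h.ne, if_pos (by omega)]
    · rw [offset_update_of_le c h.le]
      subst h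
      rw [Function.update_self, ih s.head (by omega) rfl]
      split_ifs <;> first | omega | (simp only [Prod.mk.injEq, and_true]; omega) | rfl
    · have := offset_add_le c h
      have e := offset_update_of_lt c h ((c i).addCaret (k - offset c i))
      have := numLeaves_addCaret hd (c i) (k := k - offset c i) (by omega)
      rw [Function.update_of_ne h.ne', if_neg (by omega), if_neg (by omega)]
      simp only [Prod.mk.injEq, and_true]
      omega

/-- A leaf of a tree is given by a finite word. -/
theorem exists_prefix (T : DTree d) (s : Stream' (Fin d)) :
    ∃ u : List (Fin d), s = u ++ₛ (T.parse s).2 ∧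
      ∀ t, T.parse (u ++ₛ t) = ((T.parse s).1, t) := by
  induction T generalizing s with
  | leaf => exact ⟨[], rfl, fun t => rfl⟩
  | node c ih =>
    obtain ⟨u, h₁, h₂⟩ := ih s.head s.tail
    refine ⟨s.head :: u, ?_, fun t => ?_⟩
    · simp only [parse, Stream'.cons_append_stream]
      rw [← h₁, Stream'.eta]
    · simp only [parse, Stream'.cons_append_stream, Stream'.head_cons, Stream'.tail_cons, h₂]

theorem parse_const_snd (T : DTree d) (a : Fin d) :
    (T.parse (Stream'.const a)).2 = Stream'.const a := by
  induction T with
  | leaf => rfl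
  | node c ih => exact ih _

theorem parse_leaf_ne_parse_node (hd : 2 ≤ d) (c : Fin d → DTree d) :
    ∃ s, ((leaf : DTree d).parse s).2 ≠ ((node c).parse s).2 := by
  -- For the word `1 0 0 0 …` a leaf leaves the initial `1` in place, whereas a node consumes it and
  -- only zeros can remain.
  refine ⟨Stream'.cons ⟨1, hd⟩ (Stream'.const ⟨0, by omega⟩), fun h => ?_⟩
  simp only [parse, Stream'.head_cons, Stream'.tail_cons, parse_const_snd] at h
  have := congrArg Stream'.head h
  rw [Stream'.head_cons] at this
  exact absurd (congrArg Fin.val this) one_ne_zero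

/-- A tree is determined by how long infinite words stay in it. -/
theorem eq_of_parse_snd_eq (hd : 2 ≤ d) {T U : DTree d}
    (h : ∀ s, (T.parse s).2 = (U.parse s).2) : T = U := by
  induction T generalizing U with
  | leaf =>
    cases U with
    | leaf => rfl
    | node e =>
      obtain ⟨s, hs⟩ := parse_leaf_ne_parse_node hd e
      exact (hs (h s)).elim
  | node c ih =>
    cases U with
    | leaf =>
      obtain ⟨s, hs⟩ := parse_leaf_ne_parse_node hd c
      exact (hs (h s).symm).elim
    | node e => exact congrArg node (funext fun i => ih i fun s => h (Stream'.cons i s))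

theorem numLeaves_pos (hd : 1 ≤ d) (T : DTree d) : 1 ≤ T.numLeaves :=
  Le.numLeaves_le (T := leaf) hd trivial

/-! ### Trees grafted at a vertex -/

/-- The tree obtained by attaching `T` at the vertex `q` of the smallest tree containing `q`. -/
def graft : List (Fin d) → DTree d → DTree d
  | [], T => T
  | a :: q, T => node (Function.update (fun _ => leaf) a (graft q T))

theorem numLeaves_update_congr (c : Fin d → DTree d) (a : Fin d) {A B : DTree d}
    (h : A.numLeaves = B.numLeaves) (i : Fin d) :
    (Function.update c a A i).numLeaves = (Function.update c a B i).numLeaves := by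
  by_cases hi : i = a
  · subst hi; simpa using h
  · rw [Function.update_of_ne hi, Function.update_of_ne hi]

theorem numLeaves_graft_congr (q : List (Fin d)) {A B : DTree d}
    (h : A.numLeaves = B.numLeaves) : (graft q A).numLeaves = (graft q B).numLeaves := by
  induction q with
  | nil => exact h
  | cons a q ih => exact Finset.sum_congr rfl fun i _ => numLeaves_update_congr _ a ih i

/-- The shift `m` counts the leaves to the left of the vertex `q`; it does not depend on `T`, so
different grafts at `q` can be compared leaf by leaf. -/
theorem parse_graft_append (q : List (Fin d)) :
    ∃ m, ∀ T s, (graft q T).parse (q ++ₛ s) = (m + (T.parse s).1, (T.parse s).2) := by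
  induction q with
  | nil => exact ⟨0, fun T s => by simp [graft]⟩
  | cons a q ih =>
    obtain ⟨m, hm⟩ := ih
    refine ⟨offset (fun _ => leaf) a + m, fun T s => ?_⟩
    simp only [graft, parse, Stream'.cons_append_stream, Stream'.head_cons, Stream'.tail_cons,
      Function.update_self, hm, offset_update_of_le _ le_rfl, add_assoc]

/-- Outside the cone of `q` the two trees have the same shape, and equal leaf counts make the
numbers of the leaves to the right of `q` agree as well. Hence a triple built from two such grafts
with trivial group element fixes all words outside the cone. -/
theorem parse_graft_congr (q : List (Fin d)) {A B : DTree d} (h : A.numLeaves = B.numLeaves)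
    {s : Stream' (Fin d)} (hs : ∀ t, s ≠ q ++ₛ t) :
    (graft q A).parse s = (graft q B).parse s := by
  induction q generalizing s with
  | nil => exact (hs s rfl).elim
  | cons a q ih =>
    have ho : ∀ i, offset (Function.update (fun _ => leaf) a (graft q A)) i
        = offset (Function.update (fun _ => leaf) a (graft q B)) i := fun i =>
      Finset.sum_congr rfl fun j _ => numLeaves_update_congr _ a (numLeaves_graft_congr q h) j
    simp only [graft, parse, ho]
    by_cases ha : s.head = a
    · subst ha
      rw [Function.update_self, Function.update_self, ih]
      intro t ht
      apply hs t
      rw [Stream'.cons_append_stream, ← ht, Stream'.eta]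
    · rw [Function.update_of_ne ha, Function.update_of_ne ha]

/-- The tree with one caret. -/
def caret (d : ℕ) : DTree d := node fun _ => leaf

end DTree

/-! ### The action on infinite words -/

namespace CloningSystem

variable {d : ℕ} {G : ℕ → Type*} [∀ n, Group (G n)] {C : CloningSystem d G}

/-- The action of a triple on infinite words: the words through the `k`-th leaf of `T₊` are sent to
those through the `ρ(g)(k)`-th leaf of `T₋` by exchanging prefixes. -/
def Moves (C : CloningSystem d G) (t : Triple d G) (s s' : Stream' (Fin d)) : Prop :=
  ∃ (k : Fin t.n) (w : Stream' (Fin d)),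
    t.pos.parse s = (k.val, w) ∧ t.neg.parse s' = ((C.ρ t.n t.g k).val, w)

theorem Moves.unique {t : Triple d G} {s s₁ s₂ : Stream' (Fin d)} (h₁ : C.Moves t s s₁)
    (h₂ : C.Moves t s s₂) : s₁ = s₂ := by
  obtain ⟨k, w, hk, e₁⟩ := h₁
  obtain ⟨l, v, hl, e₂⟩ := h₂
  have h := hk.symm.trans hl
  simp only [Prod.mk.injEq] at h
  obtain ⟨h, rfl⟩ := h
  obtain rfl := Fin.ext h
  exact t.neg.parse_injective (e₁.trans e₂.symm)

theorem exists_moves (t : Triple d G) (s : Stream' (Fin d)) : ∃ s', C.Moves t s s' := by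
  have hk := t.pos.parse_fst_lt s
  rw [t.pos_numLeaves] at hk
  obtain ⟨s', hs'⟩ := t.neg.exists_parse_eq (k := (C.ρ t.n t.g ⟨_, hk⟩).val)
    (by rw [t.neg_numLeaves]; exact Fin.is_lt _) (t.pos.parse s).2
  exact ⟨s', ⟨_, hk⟩, _, rfl, hs'⟩

/-- `parse_addCaret` renumbers the leaves of both trees in the way `symClone` renumbers domain and
codomain, so the new leaves still correspond under the cloned element. -/
theorem Moves.expand (hC : C.FullyCompatible) {t : Triple d G} {s s' : Stream' (Fin d)}
    (h : C.Moves t s s') (l : Fin t.n) : C.Moves (C.expand t l) s s' := by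
  obtain ⟨k, w, e₁, e₂⟩ := h
  have hd := C.two_le
  have p₁ := DTree.parse_addCaret (by omega) t.pos (by rw [t.pos_numLeaves]; exact l.is_lt) e₁
  have p₂ := DTree.parse_addCaret (by omega) t.neg
    (by rw [t.neg_numLeaves]; exact (C.ρ t.n t.g l).is_lt) e₂
  rcases lt_trichotomy k l with hkl | rfl | hkl
  · have hkl' : k.val < l.val := hkl
    refine ⟨Fin.castAdd (d - 1) k, w, ?_, ?_⟩
    · rw [if_pos hkl'] at p₁
      exact p₁
    · refine p₂.trans ?_
      have hne : C.ρ t.n t.g k ≠ C.ρ t.n t.g l := fun h' => hkl.ne ((C.ρ t.n t.g).injective h')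
      -- The image leaves differ, so the middle case of `parse_addCaret` cannot occur in the first
      -- tree.
      have hne' : (C.ρ t.n t.g k).val ≠ (C.ρ t.n t.g l).val := fun h' => hne (Fin.ext h')
      have := congrArg Fin.val (hC t.n l t.g (Fin.castAdd (d - 1) k))
      change _ = ((C.ρ (t.n + (d - 1)) (C.κ t.n l t.g) (Fin.castAdd (d - 1) k)).val, _)
      rw [this]
      simp only [symClone, Equiv.ofBijective_apply, symCloneFun, Fin.val_castAdd, hkl', dite_true,
        Fin.lt_def]
      split_ifs <;> rfl
  -- The next letter of `w` selects the same child of the new caret in both trees. The point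
  -- considered lies inside the cloned block, where (C3) says nothing and full compatibility is
  -- essential.
  · have hw := w.head.is_lt
    refine ⟨⟨k.val + w.head.val, by simp only [CloningSystem.expand]; omega⟩, w.tail, ?_, ?_⟩
    · rw [if_neg (lt_irrefl _), if_pos rfl] at p₁
      exact p₁
    · rw [if_neg (lt_irrefl _), if_pos rfl] at p₂
      refine p₂.trans ?_
      have := congrArg Fin.val (hC t.n k t.g ⟨k.val + w.head.val, by omega⟩)
      change _ = ((C.ρ (t.n + (d - 1)) (C.κ t.n k t.g) ⟨k.val + w.head.val, by omega⟩).val, _)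
      rw [this]
      have h₁ : ¬ k.val + w.head.val < k.val := by omega
      have h₂ : k.val + w.head.val ≤ k.val + (d - 1) := by omega
      simp only [symClone, Equiv.ofBijective_apply, symCloneFun, h₁, h₂, dite_true, dite_false,
        Nat.add_sub_cancel_left]
  · have hkl' : l.val < k.val := hkl
    refine ⟨Fin.addNat k (d - 1), w, ?_, ?_⟩
    · rw [if_neg (by omega), if_neg (by omega)] at p₁
      exact p₁
    · refine p₂.trans ?_
      have hne : C.ρ t.n t.g k ≠ C.ρ t.n t.g l := fun h' => hkl.ne' ((C.ρ t.n t.g).injective h')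
      have hne' : (C.ρ t.n t.g k).val ≠ (C.ρ t.n t.g l).val := fun h' => hne (Fin.ext h')
      have := congrArg Fin.val (hC t.n l t.g (Fin.addNat k (d - 1)))
      change _ = ((C.ρ (t.n + (d - 1)) (C.κ t.n l t.g) (Fin.addNat k (d - 1))).val, _)
      rw [this]
      have h₁ : ¬ (k.val + (d - 1) < l.val) := by omega
      have h₂ : ¬ (k.val + (d - 1) ≤ l.val + (d - 1)) := by omega
      simp only [symClone, Equiv.ofBijective_apply, symCloneFun, Fin.val_addNat, h₁, h₂,
        dite_false, Nat.add_sub_cancel, Fin.eta, Fin.lt_def]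
      split_ifs <;> rfl

theorem Moves.expands (hC : C.FullyCompatible) {t u : Triple d G} {s s' : Stream' (Fin d)}
    (h : C.Moves t s s') (hu : C.Expands t u) : C.Moves u s s' := by
  induction hu with
  | refl => exact h
  | tail _ h' ih =>
    obtain ⟨k, rfl⟩ := h'
    exact ih.expand hC k

theorem Moves.eq_of_cls_eq (hC : C.FullyCompatible) {t₁ t₂ : Triple d G}
    {s s₁ s₂ : Stream' (Fin d)} (h₁ : C.Moves t₁ s s₁) (h₂ : C.Moves t₂ s s₂)
    (h : C.cls t₁ = C.cls t₂) : s₁ = s₂ := by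
  obtain ⟨u, e₁, e₂⟩ := exists_common_expansion h
  exact (h₁.expands hC e₁).unique (h₂.expands hC e₂)

theorem exists_moves_of_class (x : C.ThompsonLike) (s : Stream' (Fin d)) :
    ∃ s' t, x = C.cls t ∧ C.Moves t s s' := by
  obtain ⟨t, rfl⟩ := exists_cls x
  obtain ⟨s', h⟩ := exists_moves (C := C) t s
  exact ⟨s', t, rfl, h⟩

/-- The image of an infinite word under an element of the Thompson-like group. -/
noncomputable def wordMap (x : C.ThompsonLike) (s : Stream' (Fin d)) : Stream' (Fin d) :=
  (exists_moves_of_class x s).choose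

/-- The value of `wordMap` comes from a chosen representative; passing to a common expansion shows
that every representative gives the same value. -/
theorem Moves.wordMap_cls (hC : C.FullyCompatible) {t : Triple d G} {s s' : Stream' (Fin d)}
    (h : C.Moves t s s') : wordMap (C.cls t) s = s' := by
  obtain ⟨u, e, hu⟩ := (exists_moves_of_class (C.cls t) s).choose_spec
  exact hu.eq_of_cls_eq hC h e.symm

/-- With representatives sharing the middle tree, the leaf reached by the right factor is the one
from which the left factor starts, and `ρ` is multiplicative. -/
theorem wordMap_mul (hC : C.FullyCompatible) (x y : C.ThompsonLike) (s : Stream' (Fin d)) :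
    wordMap (x * y) s = wordMap x (wordMap y s) := by
  obtain ⟨-, n, A, B, E, g, h, hA, hB, hE, rfl, rfl, -⟩ := exists_isProd x y
  obtain ⟨s', h₁⟩ := exists_moves (C := C) ⟨n, B, h, E, hB, hE⟩ s
  obtain ⟨s'', h₂⟩ := exists_moves (C := C) ⟨n, A, g, B, hA, hB⟩ s'
  rw [cls_mul_cls, h₁.wordMap_cls hC, h₂.wordMap_cls hC]
  refine Moves.wordMap_cls hC ?_
  obtain ⟨k, w, a₁, b₁⟩ := h₁
  obtain ⟨l, v, a₂, b₂⟩ := h₂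
  have e := b₁.symm.trans a₂
  simp only [Prod.mk.injEq] at e
  obtain ⟨e, rfl⟩ := e
  obtain rfl := Fin.ext e
  exact ⟨k, w, a₁, by simpa using b₂⟩

theorem wordMap_one (hC : C.FullyCompatible) (s : Stream' (Fin d)) :
    wordMap (1 : C.ThompsonLike) s = s :=
  Moves.wordMap_cls hC (t := ⟨1, .leaf, 1, .leaf, rfl, rfl⟩) ⟨⟨0, one_pos⟩, s, rfl, by simp; rfl⟩

/-- The action of the Thompson-like group on the Cantor set of infinite words. -/
noncomputable def wordAction (hC : C.FullyCompatible) :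
    C.ThompsonLike →* Equiv.Perm (Stream' (Fin d)) :=
  -- A group acting by self-maps acts by bijections, so no inverse has to be exhibited.
  MonoidHom.toHomPerm
    { toFun := fun x => (wordMap x : Function.End (Stream' (Fin d)))
      map_one' := funext (wordMap_one hC)
      map_mul' := fun x y => funext (wordMap_mul hC x y) }

theorem Moves.wordAction_cls (hC : C.FullyCompatible) {t : Triple d G} {s s' : Stream' (Fin d)}
    (h : C.Moves t s s') : wordAction hC (C.cls t) s = s' :=
  h.wordMap_cls hC

/-! ### Elements acting non-trivially -/

/-- An element that moves some word moves a whole cone off itself. -/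
theorem exists_cone_of_ne (hC : C.FullyCompatible) {x : C.ThompsonLike} {s : Stream' (Fin d)}
    (h : wordAction hC x s ≠ s) :
    ∃ q : List (Fin d), ∀ t t', wordAction hC x (q ++ₛ t) ≠ q ++ₛ t' := by
  obtain ⟨t, rfl⟩ := exists_cls x
  obtain ⟨s', k, w, h₁, h₂⟩ := exists_moves (C := C) t s
  rw [Moves.wordAction_cls hC ⟨k, w, h₁, h₂⟩] at h
  obtain ⟨u, hu₁, hu₂⟩ := t.pos.exists_prefix s
  obtain ⟨v, hv₁, hv₂⟩ := t.neg.exists_prefix s'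
  rw [h₁] at hu₁ hu₂
  rw [h₂] at hv₁ hv₂
  dsimp only at hu₁ hu₂ hv₁ hv₂
  -- The word and its image differ at some position `m`. Keeping `m + 1` letters of the common
  -- remainder `w` after each of the prefixes `u` and `v` fixes position `m` in both, even if a
  -- prefix is empty; so the cone and its image are disjoint.
  obtain ⟨m, hm⟩ : ∃ m, s'.get m ≠ s.get m := by
    by_contra! H
    exact h (Stream'.ext H)
  have key : ∀ (u : List (Fin d)) (y : Stream' (Fin d)),
      ((u ++ w.take (m + 1)) ++ₛ y).get m = (u ++ₛ w).get m := by
    intro u y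
    have hlt : m < (u ++ w.take (m + 1)).length := by
      rw [List.length_append, Stream'.length_take]; omega
    rw [Stream'.get_append_left _ _ _ hlt]
    conv_rhs => rw [← Stream'.append_take_drop (m + 1) w, ← Stream'.append_append_stream]
    rw [Stream'.get_append_left _ _ _ hlt]
  refine ⟨u ++ w.take (m + 1), fun y y' e => hm ?_⟩
  have hx : wordAction hC (C.cls t) ((u ++ w.take (m + 1)) ++ₛ y)
      = (v ++ w.take (m + 1)) ++ₛ y := by
    rw [Stream'.append_append_stream, Stream'.append_append_stream]
    exact Moves.wordAction_cls hC ⟨k, _, hu₂ _, hv₂ _⟩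
  rw [hx] at e
  rw [hu₁, hv₁, ← key u y', ← key v y, e]

/-- For every cone there is an element of infinite order supported on it. -/
theorem exists_supported_on_cone (hC : C.FullyCompatible) (q : List (Fin d)) :
    ∃ f : C.ThompsonLike, (∀ s, (∀ t, s ≠ q ++ₛ t) → wordAction hC f s = s) ∧
      ∃ a b : Fin d, b ≠ a ∧ ∀ t, wordAction hC f (q ++ₛ Stream'.cons a t)
        = q ++ₛ Stream'.cons a (Stream'.cons a t) := by
  have hd := C.two_le
  -- `A` and `B` are a caret with a second caret on child `a`, respectively `b`. Since `a` is the
  -- leftmost letter, the leaf `a` of `B` and the leaf `a a` of `A` both have number `0`, whence `a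
  -- t ↦ a a t` below `q`.
  let a : Fin d := ⟨0, by omega⟩
  let b : Fin d := ⟨1, by omega⟩
  have hba : b ≠ a := fun h => one_ne_zero (congrArg Fin.val h)
  have ho : ∀ c : Fin d → DTree d, DTree.offset c a = 0 := fun c =>
    Finset.sum_eq_zero fun j hj => absurd (Finset.mem_Iio.1 hj) (by simp [a, Fin.lt_def])
  have hn : ∀ i : Fin d, (DTree.graft [i] (DTree.caret d)).numLeaves = d + (d - 1) := fun i => by
    rw [DTree.graft, DTree.numLeaves, ← Finset.add_sum_erase _ _ (Finset.mem_univ i),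
      Finset.sum_congr rfl (g := fun _ => 1) fun j hj => by
        rw [Function.update_of_ne (Finset.ne_of_mem_erase hj), DTree.numLeaves],
      Function.update_self]
    simp [DTree.graft, DTree.caret, DTree.numLeaves]
  set A := DTree.graft [a] (DTree.caret d) with hA
  set B := DTree.graft [b] (DTree.caret d) with hB
  have hAB : A.numLeaves = B.numLeaves := (hn a).trans (hn b).symm
  refine ⟨C.cls ⟨_, DTree.graft q A, 1, DTree.graft q B,
    DTree.numLeaves_graft_congr q hAB, rfl⟩, fun s hs => ?_, a, b, hba, fun t => ?_⟩
  · refine Moves.wordAction_cls hC ⟨⟨_, DTree.parse_fst_lt _ s⟩, _, rfl, ?_⟩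
    rw [map_one]
    exact DTree.parse_graft_congr q hAB hs
  · obtain ⟨m, hm⟩ := DTree.parse_graft_append q
    refine Moves.wordAction_cls hC ⟨⟨_, DTree.parse_fst_lt _ _⟩, _, rfl, ?_⟩
    rw [map_one]
    change DTree.parse _ _ = DTree.parse _ _
    rw [hm, hm]
    simp [hA, hB, DTree.graft, DTree.caret, DTree.parse, ho, Function.update_of_ne hba.symm]

/-- If two of the conjugates of `x` by powers of `f` agree, a positive power of `f` commutes with
`x`. That power moves a word of the cone, yet fixes the image of this word under `x`, which lies
outside the cone. -/
theorem infinite_conjugatesOf_of_ne (hC : C.FullyCompatible) {x : C.ThompsonLike}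
    {s : Stream' (Fin d)} (h : wordAction hC x s ≠ s) : (conjugatesOf x).Infinite := by
  obtain ⟨q, hq⟩ := exists_cone_of_ne hC h
  obtain ⟨f, hf, a, b, hba, hfa⟩ := exists_supported_on_cone hC q
  have hpow : ∀ (m : ℕ) (t : Stream' (Fin d)), ∃ t',
      wordAction hC (f ^ (m + 1)) (q ++ₛ Stream'.cons a t)
        = q ++ₛ Stream'.cons a (Stream'.cons a t') := by
    intro m t
    induction m with
    | zero => exact ⟨t, by rw [zero_add, pow_one, hfa]⟩
    | succ m ih =>
      obtain ⟨t', ht'⟩ := ih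
      exact ⟨_, by rw [pow_succ', map_mul, Equiv.Perm.mul_apply, ht', hfa]⟩
  have hfix : ∀ (m : ℕ) (s), (∀ t, s ≠ q ++ₛ t) → wordAction hC (f ^ m) s = s := by
    intro m s hs
    rw [map_pow]
    exact Function.IsFixedPt.perm_pow (hf s hs) m
  refine Set.infinite_of_injective_forall_mem (f := fun i : ℕ => f ^ i * x * (f ^ i)⁻¹) ?_
    fun i => isConj_iff.2 ⟨f ^ i, rfl⟩
  refine Function.Injective.of_lt_imp_ne fun i j hij e => ?_
  obtain ⟨m, rfl⟩ := Nat.exists_eq_add_of_lt hij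
  have hcomm : x * f ^ (m + 1) = f ^ (m + 1) * x := by
    rw [add_assoc, pow_add] at e
    have e' := congrArg (fun z => (f ^ i)⁻¹ * z * (f ^ i * f ^ (m + 1))) e
    simpa [mul_assoc] using e'
  -- After `q` the word `p` continues with `a b`, while its image under any positive power of `f`
  -- continues with `a a`.
  set p := q ++ₛ Stream'.cons a (Stream'.const b) with hp
  have h₁ : wordAction hC x (wordAction hC (f ^ (m + 1)) p) = wordAction hC x p := by
    rw [← Equiv.Perm.mul_apply, ← map_mul, hcomm, map_mul, Equiv.Perm.mul_apply]
    -- `x` moves `p` out of the cone, where powers of `f` act trivially.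
    exact hfix _ _ fun t => hq _ t
  obtain ⟨t', ht'⟩ := hpow m (Stream'.const b)
  have h₂ := (wordAction hC x).injective h₁
  rw [hp, ht'] at h₂
  have h₃ := congrArg Stream'.head (congrArg Stream'.tail (Stream'.append_right_injective q _ _ h₂))
  exact hba h₃.symm

/-! ### The embeddings of the groups `G n` -/

/-- Cloning maps send `1` to `1` and are injective, so no expansion can make a non-trivial group
element trivial. -/
theorem Expands.g_eq_one {t s : Triple d G} (h : C.Expands t s) (hs : s.g = 1) : t.g = 1 := by
  induction h with
  | refl => exact hs
  | tail _ h ih =>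
    obtain ⟨k, rfl⟩ := h
    exact ih (C.κ_injective _ k (hs.trans (κ_one _ k).symm))

/-- The embedding of `G n` into the Thompson-like group given by a tree with `n` leaves. -/
noncomputable def treeHom (C : CloningSystem d G) {n : ℕ} (A : DTree d) (hA : A.numLeaves = n) :
    G n →* C.ThompsonLike where
  toFun g := C.cls ⟨n, A, g, A, hA, hA⟩
  map_one' := cls_one A hA
  map_mul' g h := (cls_mul_cls g h hA hA hA).symm

/-- If `[A, g, A]` is trivial, it has a common expansion with `(A, 1, A)`, whose expansions all
carry the group element `1`. -/
theorem treeHom_injective {n : ℕ} (A : DTree d) (hA : A.numLeaves = n) :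
    Function.Injective (C.treeHom A hA) := by
  refine (injective_iff_map_eq_one _).2 fun g hg => ?_
  obtain ⟨u, h₁, h₂⟩ := exists_common_expansion (hg.trans (cls_one A hA).symm)
  exact h₁.g_eq_one (h₂.one hA).1

end CloningSystem

/-! ### The two cases combined -/

theorem mainTheorem3 {d : ℕ} {G : ℕ → Type*} [∀ n, Group (G n)] (C : CloningSystem d G)
    (hC : C.FullyCompatible) (hG : ∀ n, 1 ≤ n → IsICC (G n)) :
    IsICC C.ThompsonLike := by
  intro x hx
  have hd := C.two_le
  by_cases h : ∃ s, CloningSystem.wordAction hC x s ≠ s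
  · obtain ⟨s, hs⟩ := h
    exact CloningSystem.infinite_conjugatesOf_of_ne hC hs
  push Not at h
  obtain ⟨⟨n, A, g, B, hA, hB⟩, rfl⟩ := CloningSystem.exists_cls x
  -- A trivial action means that each word leaves `A` and `B` with the same remainder, and these
  -- remainders determine the tree.
  obtain rfl : A = B := by
    refine DTree.eq_of_parse_snd_eq hd fun s => ?_
    obtain ⟨s', hs⟩ := CloningSystem.exists_moves (C := C) ⟨n, A, g, B, hA, hB⟩ s
    obtain rfl : s' = s := (hs.wordAction_cls hC).symm.trans (h s)
    obtain ⟨k, w, h₁, h₂⟩ := hs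
    dsimp only at h₁ h₂
    rw [h₁, h₂]
  have hg : g ≠ 1 := by
    rintro rfl
    exact hx (CloningSystem.cls_one A hA)
  have hinf := hG n (hA ▸ DTree.numLeaves_pos (by omega) A) g hg
  -- Homomorphisms preserve conjugacy, so the injective image of the conjugacy class of `g` lies in
  -- that of `x`.
  refine (hinf.image (CloningSystem.treeHom_injective (C := C) A hA).injOn).mono ?_
  rintro _ ⟨g', hg', rfl⟩
  exact (C.treeHom A hA).map_isConj hg'
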